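/- Let $f\in C^2(\mathbb R^{n}\times\mathbb R,\mathbb R^n)$, let $\lambda_-<\lambda_+$, and let $$\mathcal X=\{(x,\lambda): f(x,\lambda)=0,\ \lambda_-\le\lambda\le\lambda_+\}$$ be the set of equilibria. Let $\mathcal X_{\rm stab}$ and $\mathcal X_{\rm bif}$ be the sets of those $(x,\lambda)\in\mathcal X$ at which the largest real part of the eigenvalues of the matrix $d_xf(x,\lambda)$ is negative and equal to $0$, respectively. Assume that $\mathcal X_{\rm bif}$ has no accumulation point and contains no point with $\lambda=\lambda_-$ or $\lambda=\lambda_+$. A *parameter shift* is a $C^2$ function $\Lambda:\mathbb R\to(\lambda_-,\lambda_+)$ with $\Lambda(s)\to\lambda_\pm$ and $\Lambda'(s)\to0$ as $s\to\pm\infty$. Points $(X_-,\lambda_-),(X_+,\lambda_+)\in\mathcal X_{\rm stab}$ are *$\Lambda$-connected* if there is a continuous $X:\mathbb R\to\mathbb R^n$ with $X(s)\to X_\pm$ as $s\to\pm\infty$ and $(X(s),\Lambda(s))\in\mathcal X\cap\overline{\mathcal X_{\rm stab}}$ for all $s$. For $(X_-,\lambda_-)\in\mathcal X_{\rm stab}$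 and $r>0$, let $\tilde x^{[\Lambda,r,X_-]}_{pb}$ denote the (unique) solution $x(t)$, $t\in\mathbb R$, of $\dot x=f(x,\Lambda(rt))$ with $x(t)\to X_-$ as $t\to-\infty$. There is *B-tipping* from $X_-$ for $\Lambda$ if $(X_-,\lambda_-)\in\mathcal X_{\rm stab}$ and there is $(X_+,\lambda_+)\in\mathcal X_{\rm stab}$, not $\Lambda$-connected to $(X_-,\lambda_-)$, such that for all sufficiently small $r>0$ this solution exists for all times and $\tilde x^{[\Lambda,r,X_-]}_{pb}(t)\to X_+$ as $t\to\infty$. A *stable branch* over $[c,d]$, $c<d$, is a continuous curve $\lambda\mapsto X(\lambda)$, $\lambda\in[c,d]$, with $(X(\lambda),\lambda)\in\mathcal X\cap\overline{\mathcal X_{\rm stab}}$, which does not meet $\mathcal X_{\rm bif}$ except possibly at its end points and is $C^2$ away from $\mathcal X_{\rm bif}$. The *stable branch starting at $X_-$* is the union of the graphs $\{(X(\lambda),\lambda)\}$ of all stable branches over intervals $[\lambda_-,d]$ with $X(\lambda_-)=X_-$. **Corollary.** Suppose that there is B-tipping from $X_-$ for some parameter shift $\Lambda$, and that the stable branch starting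 at $X_-$ is bounded (it does not escape to infinity). Then the stable branch starting at $X_-$ contains a bifurcation point $(x_b,\lambda_b)\in\mathcal X_{\rm bif}$ with $\lambda_-<\lambda_b<\lambda_+$. -/

import Mathlib

open Filter Topology Set

namespace Tipping

/-- The state space `ℝⁿ` with its Euclidean norm. -/
abbrev State (n : ℕ) := EuclideanSpace ℝ (Fin n)

/-- The matrix `df(x,λ)` of partial derivatives of `f` with respect to the state variable. -/
noncomputable def jacobian {n : ℕ} (f : State n → ℝ → State n) (x : State n) (l : ℝ) :
    Matrix (Fin n) (Fin n) ℝ :=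
  fun i j => fderiv ℝ (fun y => f y l) x (EuclideanSpace.single j 1) i

/-- The complex spectrum (set of eigenvalues) of the matrix `df(x,λ)`. -/
noncomputable def jacSpectrum {n : ℕ} (f : State n → ℝ → State n) (x : State n) (l : ℝ) : Set ℂ :=
  spectrum ℂ ((jacobian f x l).map (algebraMap ℝ ℂ))

/-- The set of equilibria `(x, λ)` of `dx/dt = f(x,λ)` with `a ≤ λ ≤ b`. -/
def equilibria {n : ℕ} (f : State n → ℝ → State n) (a b : ℝ) : Set (State n × ℝ) :=
  {p | f p.1 p.2 = 0 ∧ a ≤ p.2 ∧ p.2 ≤ b}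

/-- Linearly stable equilibria: all eigenvalues of `df` have negative real part. -/
def stabSet {n : ℕ} (f : State n → ℝ → State n) (a b : ℝ) : Set (State n × ℝ) :=
  {p | p ∈ equilibria f a b ∧ ∀ z ∈ jacSpectrum f p.1 p.2, z.re < 0}

/-- Bifurcation equilibria: the largest real part of an eigenvalue of `df` is equal to `0`. -/
def bifSet {n : ℕ} (f : State n → ℝ → State n) (a b : ℝ) : Set (State n × ℝ) :=
  {p | p ∈ equilibria f a b ∧ IsGreatest (Complex.re '' jacSpectrum f p.1 p.2) 0}

/-- The class `𝒫(a,b)` of parameter shifts. -/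
structure IsParameterShift (a b : ℝ) (L : ℝ → ℝ) : Prop where
  contDiff : ContDiff ℝ 2 L
  mem_Ioo : ∀ s, a < L s ∧ L s < b
  tendsto_atBot : Tendsto L atBot (𝓝 a)
  tendsto_atTop : Tendsto L atTop (𝓝 b)
  deriv_atBot : Tendsto (deriv L) atBot (𝓝 0)
  deriv_atTop : Tendsto (deriv L) atTop (𝓝 0)

/-- `(X(s), Λ(s))` is a path from `(Xm, a)` to `(Xp, b)` (for a parameter shift `Λ ∈ 𝒫(a,b)`):
a continuous curve in the set of equilibria that has these limits as `s → ∓∞`. -/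
structure IsPath {n : ℕ} (f : State n → ℝ → State n) (a b : ℝ) (L : ℝ → ℝ)
    (Xm Xp : State n) (X : ℝ → State n) : Prop where
  continuous : Continuous X
  mem_equilibria : ∀ s, (X s, L s) ∈ equilibria f a b
  tendsto_atBot : Tendsto X atBot (𝓝 Xm)
  tendsto_atTop : Tendsto X atTop (𝓝 Xp)

/-- A path is stable if it lies in the closure of the set of linearly stable equilibria. -/
structure IsStablePath {n : ℕ} (f : State n → ℝ → State n) (a b : ℝ) (L : ℝ → ℝ)
    (Xm Xp : State n) (X : ℝ → State n) : Prop extends IsPath f a b L Xm Xp X where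
  mem_closure : ∀ s, (X s, L s) ∈ closure (stabSet f a b)

/-- `(Xm, a)` and `(Xp, b)` are stable equilibria that lie on the same stable path. -/
def LambdaConnected {n : ℕ} (f : State n → ℝ → State n) (a b : ℝ) (L : ℝ → ℝ)
    (Xm Xp : State n) : Prop :=
  (Xm, a) ∈ stabSet f a b ∧ (Xp, b) ∈ stabSet f a b ∧ ∃ X, IsStablePath f a b L Xm Xp X

/-- A branch `X(λ)`, `c ≤ λ ≤ d`: a curve of equilibria, parametrized by `λ`, that meets the set of
bifurcation equilibria at most at its end points. It is continuous, and `C²` at all its points that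
are not bifurcation equilibria (at a fold, where a branch ends, `X` behaves like a square root and
is not differentiable as a function of `λ`). -/
structure IsBranch {n : ℕ} (f : State n → ℝ → State n) (a b : ℝ) (c d : ℝ)
    (X : ℝ → State n) : Prop where
  lt : c < d
  continuousOn : ContinuousOn X (Icc c d)
  contDiffOn : ContDiffOn ℝ 2 X {l | l ∈ Icc c d ∧ (X l, l) ∉ bifSet f a b}
  mem_equilibria : ∀ l ∈ Icc c d, (X l, l) ∈ equilibria f a b
  notMem_bif : ∀ l ∈ Ioo c d, (X l, l) ∉ bifSet f a b

/-- A branch is stable if it lies in the closure of the set of linearly stable equilibria. -/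
structure IsStableBranch {n : ℕ} (f : State n → ℝ → State n) (a b : ℝ) (c d : ℝ)
    (X : ℝ → State n) : Prop extends IsBranch f a b c d X where
  mem_closure : ∀ l ∈ Icc c d, (X l, l) ∈ closure (stabSet f a b)

/-- The (maximal) stable branch starting at `Xm`, as a set of points `(x, λ)`: the union of all
stable branches over intervals `[a, d]` that start at `(Xm, a)`. -/
def stableBranchFrom {n : ℕ} (f : State n → ℝ → State n) (a b : ℝ) (Xm : State n) :
    Set (State n × ℝ) :=
  {p | ∃ (d : ℝ) (X : ℝ → State n), IsStableBranch f a b a d X ∧ X a = Xm ∧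
    p.2 ∈ Icc a d ∧ p.1 = X p.2}

/-- `x` is a trajectory, defined for all times, of `dx/dt = f(x, Λ(r t))` with `x(t) → Xm` as
`t → -∞`. For a linearly stable equilibrium `(Xm, a)` there is only one such trajectory; it is the
pullback attractor with past limit `Xm`. -/
structure IsPullbackAttractorFrom {n : ℕ} (f : State n → ℝ → State n) (L : ℝ → ℝ) (r : ℝ)
    (Xm : State n) (x : ℝ → State n) : Prop where
  hasDerivAt : ∀ t, HasDerivAt x (f (x t) (L (r * t))) t
  tendsto_atBot : Tendsto x atBot (𝓝 Xm)

/-- B-tipping from `Xm` for the parameter shift `Λ`: for some stable `(Xp, b)` that is not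
`Λ`-connected to the stable `(Xm, a)`, the pullback attractor with past limit `Xm` converges to
`Xp` as `t → ∞`, for all small enough rates `r > 0`. -/
def BTipping {n : ℕ} (f : State n → ℝ → State n) (a b : ℝ) (L : ℝ → ℝ) (Xm : State n) : Prop :=
  (Xm, a) ∈ stabSet f a b ∧
  ∃ Xp : State n, (Xp, b) ∈ stabSet f a b ∧
    (∃ r₀ > 0, ∀ r, 0 < r → r < r₀ →
      ∃ x, IsPullbackAttractorFrom f L r Xm x ∧ Tendsto x atTop (𝓝 Xp)) ∧
    ¬ LambdaConnected f a b L Xm Xp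

end Tipping

/-! Suppose the branch starting at `Xm` met no bifurcation point. It would then consist of linearly
stable equilibria and could be continued over the whole of `[a, b]`; slow solutions would follow it
to its end point, so that end point would be the B-tipping target. The branch composed with `L`
would be a stable path to the target, contradicting the absence of a `Λ`-connection.

Continuation (`exists_mem_bifSet_or_isStabCurve`) takes the supremum of the parameters reached by
stable curves. Boundedness provides cluster points there. They are isolated, by the implicit
function theorem at a stable equilibrium or by the assumption on bifurcation points, so the curve
converges (`exists_tendsto_of_isBounded`). The limit is stable or a bifurcation point; if it is
stable, the curve extends further unless it has already reached `b`.

Tracking (`tracksOn_univ`) rests on a quadratic Lyapunov form at each stable equilibrium, which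
makes `f` contracting nearby (`exists_one_sided_lipschitz`). In slow time the contraction has rate
of order `1/r`, while the curve moves with bounded speed. Neighbourhoods of the two ends cover
unbounded times, and connectedness of `ℝ` joins the local estimates between them. -/

namespace Tipping

/-! ### Hurwitz matrices: Euler steps and semicontinuity of the spectrum. -/

section Hurwitz

variable {n : ℕ}

attribute [local instance] Matrix.linftyOpNormedRing Matrix.linftyOpNormedAlgebra

/-- The powers of a complex matrix with spectrum in the open unit disc tend to zero. -/
theorem tendsto_pow_of_spectrum_lt_one (M : Matrix (Fin n) (Fin n) ℂ)
    (h : ∀ z ∈ spectrum ℂ M, ‖z‖ < 1) : Tendsto (fun k => M ^ k) atTop (𝓝 0) := by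
  rcases subsingleton_or_nontrivial (Matrix (Fin n) (Fin n) ℂ) with hs | hs
  · have : (fun k => M ^ k) = fun _ => 0 := funext fun k => Subsingleton.elim _ _
    rw [this]
    exact tendsto_const_nhds
  have hr : spectralRadius ℂ M < ((1 : NNReal) : ENNReal) :=
    spectrum.spectralRadius_lt_of_forall_lt M fun z hz => by
      have := h z hz
      exact_mod_cast this
  obtain ⟨q, hq1, hq2⟩ := ENNReal.lt_iff_exists_nnreal_btwn.1 hr
  have hq2' : (q : ℝ) < 1 := by exact_mod_cast hq2
  -- Gelfand's formula bounds `‖M ^ k‖` by `q ^ k` for large `k`, with `q < 1`.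
  have hev := (spectrum.pow_nnnorm_pow_one_div_tendsto_nhds_spectralRadius M).eventually_lt_const hq1
  refine squeeze_zero_norm' (a := fun k => (q : ℝ) ^ k) ?_
    (tendsto_pow_atTop_nhds_zero_of_lt_one q.coe_nonneg hq2')
  filter_upwards [hev, eventually_gt_atTop 0] with k hk hk0
  have hk0' : (0 : ℝ) < k := by exact_mod_cast hk0
  have h1 := ENNReal.rpow_le_rpow hk.le hk0'.le
  rw [← ENNReal.rpow_mul, one_div_mul_cancel hk0'.ne', ENNReal.rpow_one, ENNReal.rpow_natCast] at h1
  exact_mod_cast h1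

/-- Since `‖1 + t z‖² = 1 + t (t ‖z‖² + 2 Re z)`, each `z` allows all small `t > 0`; finiteness
gives a common `t`. -/
theorem exists_forall_norm_one_add_mul_lt_one {s : Set ℂ} (hs : s.Finite)
    (h : ∀ z ∈ s, z.re < 0) : ∃ t : ℝ, 0 < t ∧ ∀ z ∈ s, ‖1 + (t : ℂ) * z‖ < 1 := by
  have key : ∀ z ∈ s, ∀ᶠ t : ℝ in 𝓝[>] 0, ‖1 + (t : ℂ) * z‖ < 1 := by
    intro z hz
    have hz0 := h z hz
    have hlim : Tendsto (fun t : ℝ => t * Complex.normSq z + 2 * z.re) (𝓝[>] 0)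
        (𝓝 (0 * Complex.normSq z + 2 * z.re)) :=
      (((continuous_id.mul continuous_const).add continuous_const).tendsto 0).mono_left
        nhdsWithin_le_nhds
    have hneg : 0 * Complex.normSq z + 2 * z.re < 0 := by linarith
    filter_upwards [hlim.eventually_lt_const hneg, self_mem_nhdsWithin] with t ht ht0
    have ht0' : (0 : ℝ) < t := ht0
    have hsq : ‖1 + (t : ℂ) * z‖ ^ 2 < 1 := by
      rw [← Complex.normSq_eq_norm_sq, Complex.normSq_apply]
      rw [Complex.normSq_apply] at ht
      simp only [Complex.add_re, Complex.one_re, Complex.mul_re, Complex.ofReal_re,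
        Complex.ofReal_im, zero_mul, sub_zero, Complex.add_im, Complex.one_im, Complex.mul_im,
        add_zero, zero_add]
      nlinarith
    nlinarith [norm_nonneg (1 + (t : ℂ) * z)]
  have := ((hs.eventually_all (l := 𝓝[>] (0 : ℝ))).2 key).and self_mem_nhdsWithin
  obtain ⟨t, ht, ht0⟩ := this.exists
  exact ⟨t, ht0, ht⟩

/-- For a real Hurwitz matrix `J`, the powers of the explicit Euler step `1 + t J` tend to zero for
some `t > 0`. -/
theorem exists_tendsto_one_add_smul_pow (J : Matrix (Fin n) (Fin n) ℝ)
    (h : ∀ z ∈ spectrum ℂ (J.map (algebraMap ℝ ℂ)), z.re < 0) :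
    ∃ t : ℝ, 0 < t ∧ Tendsto (fun k => (1 + t • J) ^ k) atTop (𝓝 0) := by
  set M := J.map (algebraMap ℝ ℂ) with hM
  obtain ⟨t, ht0, ht⟩ := exists_forall_norm_one_add_mul_lt_one (Matrix.finite_spectrum M) h
  refine ⟨t, ht0, ?_⟩
  have htc : (t : ℂ) ≠ 0 := by exact_mod_cast ht0.ne'
  have hspec : ∀ z ∈ spectrum ℂ (1 + (t : ℂ) • M), ‖z‖ < 1 := by
    intro z hz
    have hz' : (z - 1) / t ∈ spectrum ℂ M := by
      rw [spectrum.mem_iff] at hz ⊢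
      contrapose! hz
      have : algebraMap ℂ (Matrix (Fin n) (Fin n) ℂ) z - (1 + (t : ℂ) • M) =
          (t : ℂ) • (algebraMap ℂ (Matrix (Fin n) (Fin n) ℂ) ((z - 1) / t) - M) := by
        simp only [Algebra.algebraMap_eq_smul_one, smul_sub, smul_smul, mul_div_cancel₀ _ htc,
          sub_smul, one_smul]
        abel
      rw [this]
      exact hz.smul (Units.mk0 (t : ℂ) htc)
    have := ht _ hz'
    rwa [mul_div_cancel₀ _ htc, add_sub_cancel] at this
  have hlim := tendsto_pow_of_spectrum_lt_one _ hspec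
  -- The complex powers have real entries, so entrywise real parts carry the limit back to `J`.
  have hmap : ∀ k, ((1 + (t : ℂ) • M) ^ k).map Complex.re = (1 + t • J) ^ k := by
    intro k
    have : 1 + (t : ℂ) • M = (Algebra.ofId ℝ ℂ).mapMatrix (1 + t • J) := by
      rw [map_add, map_one, map_smul]
      ext i j
      simp [hM]
    rw [this, ← map_pow]
    ext i j
    simp [Algebra.ofId_apply]
  have hcont : Continuous fun N : Matrix (Fin n) (Fin n) ℂ => N.map Complex.re :=
    continuous_id.matrix_map Complex.continuous_re
  have := ((hcont.tendsto 0).comp hlim).congr hmap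
  rwa [Matrix.map_zero _ Complex.zero_re] at this

theorem isOpen_setOf_hurwitz :
    IsOpen {J : Matrix (Fin n) (Fin n) ℝ |
      ∀ z ∈ spectrum ℂ (J.map (algebraMap ℝ ℂ)), z.re < 0} := by
  have hcont : Continuous fun J : Matrix (Fin n) (Fin n) ℝ => J.map (algebraMap ℝ ℂ) :=
    continuous_id.matrix_map (by simpa using Complex.continuous_ofReal)
  have hopen : IsOpen {z : ℂ | z.re < 0} := isOpen_lt Complex.continuous_re continuous_const
  have h2 : IsOpen {M : Matrix (Fin n) (Fin n) ℂ | spectrum ℂ M ⊆ {z : ℂ | z.re < 0}} := by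
    rw [isOpen_iff_mem_nhds]
    intro M hM
    exact (upperHemicontinuous_iff_forall_isOpen.1
      (upperHemicontinuous_spectrum ℂ (Matrix (Fin n) (Fin n) ℂ))) M _ hopen hM
  exact h2.preimage hcont

/-- The characteristic polynomial is a product of `n` factors `z - w` with `Re w ≤ 0`, each of norm
at least `Re z`. -/
theorem re_pow_le_norm_eval_charpoly {M : Matrix (Fin n) (Fin n) ℂ}
    (h : ∀ z ∈ spectrum ℂ M, z.re ≤ 0) {z : ℂ} (hz : 0 < z.re) :
    z.re ^ n ≤ ‖M.charpoly.eval z‖ := by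
  have hsplit := IsAlgClosed.splits M.charpoly
  have hcard : M.charpoly.roots.card = n := by
    rw [← hsplit.natDegree_eq_card_roots, Matrix.charpoly_natDegree_eq_dim, Fintype.card_fin]
  have hroot : ∀ w ∈ M.charpoly.roots, w.re ≤ 0 := fun w hw =>
    h w (Matrix.mem_spectrum_iff_isRoot_charpoly.2 (Polynomial.isRoot_of_mem_roots hw))
  rw [hsplit.eval_eq_prod_roots_of_monic M.charpoly_monic]
  have : ∀ s : Multiset ℂ, (∀ w ∈ s, w.re ≤ 0) →
      z.re ^ s.card ≤ ‖(s.map fun w => z - w).prod‖ := by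
    intro s
    induction s using Multiset.induction_on with
    | empty => simp
    | cons a s ih =>
      intro hs
      rw [Multiset.card_cons, Multiset.map_cons, Multiset.prod_cons, norm_mul, pow_succ']
      have h1 : z.re ≤ ‖z - a‖ := by
        have := Complex.re_le_norm (z - a)
        have h2 := hs a (Multiset.mem_cons_self a s)
        rw [Complex.sub_re] at this
        linarith
      exact mul_le_mul h1 (ih fun w hw => hs w (Multiset.mem_cons_of_mem hw)) (by positivity)
        (norm_nonneg _)
  have := this _ hroot
  rwa [hcard] at this

/-- The quantitative bound `(Re z) ^ n ≤ ‖charpoly z‖` for all `Re z > 0` is equivalent to the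
absence of eigenvalues in the open right half-plane. It is a closed condition by continuity of the
determinant, so no continuity of eigenvalues is needed. -/
theorem isClosed_setOf_spectrum_re_nonpos :
    IsClosed {J : Matrix (Fin n) (Fin n) ℝ |
      ∀ z ∈ spectrum ℂ (J.map (algebraMap ℝ ℂ)), z.re ≤ 0} := by
  have hcont : Continuous fun J : Matrix (Fin n) (Fin n) ℝ => J.map (algebraMap ℝ ℂ) :=
    continuous_id.matrix_map (by simpa using Complex.continuous_ofReal)
  have hdet : ∀ z : ℂ, Continuous fun J : Matrix (Fin n) (Fin n) ℝ =>
      ‖(J.map (algebraMap ℝ ℂ)).charpoly.eval z‖ := by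
    intro z
    simp_rw [Matrix.eval_charpoly]
    exact (Continuous.matrix_det (continuous_const.sub hcont)).norm
  have : {J : Matrix (Fin n) (Fin n) ℝ |
      ∀ z ∈ spectrum ℂ (J.map (algebraMap ℝ ℂ)), z.re ≤ 0} =
      ⋂ z : ℂ, ⋂ _ : 0 < z.re,
        {J | z.re ^ n ≤ ‖(J.map (algebraMap ℝ ℂ)).charpoly.eval z‖} := by
    ext J
    simp only [mem_ofPred_eq, mem_iInter]
    refine ⟨fun h z hz => re_pow_le_norm_eval_charpoly h hz, fun h z hz => ?_⟩
    by_contra! hz0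
    have h1 := h z hz0
    rw [Matrix.mem_spectrum_iff_isRoot_charpoly, Polynomial.IsRoot] at hz
    rw [hz, norm_zero] at h1
    exact absurd (pow_pos hz0 n) (not_lt.2 h1)
  rw [this]
  exact isClosed_iInter fun z => isClosed_iInter fun _ => isClosed_le continuous_const (hdet z)

end Hurwitz

/-! ### Quadratic Lyapunov functions. -/

section Lyapunov

variable {E : Type*} [NormedAddCommGroup E] [InnerProductSpace ℝ E]

/-- A continuous linear map `A` has a quadratic Lyapunov function if the powers of an explicit Euler
step `1 + t A` tend to zero. -/
theorem exists_lyapunov_form (A : E →L[ℝ] E) {t : ℝ} (ht : 0 < t)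
    (h : Tendsto (fun k => (1 + t • A) ^ k) atTop (𝓝 0)) :
    ∃ Q : E →L[ℝ] E →L[ℝ] ℝ, (∀ v w, Q v w = Q w v) ∧ (∀ v, ‖v‖ ^ 2 ≤ Q v v) ∧
      ∃ c > 0, ∀ v, Q v (A v) ≤ -c * ‖v‖ ^ 2 := by
  set B := 1 + t • A with hB
  have hn : Tendsto (fun k => ‖B ^ k‖) atTop (𝓝 0) := by simpa using h.norm
  obtain ⟨N, hN, hN0⟩ := ((hn.eventually_lt_const (show (0 : ℝ) < 1 / 2 by norm_num)).and
    (eventually_gt_atTop 0)).exists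
  -- A finite truncation of the discrete Lyapunov sum: the term `k = 0` gives the lower bound, and
  -- passing from `v` to `B v` telescopes, leaving an error `‖B ^ N v‖² ≤ ‖v‖² / 4`.
  let Q : E →L[ℝ] E →L[ℝ] ℝ :=
    ∑ k ∈ Finset.range N, (innerSL ℝ).bilinearComp (B ^ k) (B ^ k)
  have hQ : ∀ v w, Q v w = ∑ k ∈ Finset.range N, inner ℝ ((B ^ k) v) ((B ^ k) w) := by
    intro v w
    simp [Q]
  have hsymm : ∀ v w, Q v w = Q w v := by
    intro v w
    rw [hQ, hQ]
    exact Finset.sum_congr rfl fun k _ => real_inner_comm _ _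
  have hQv : ∀ v, Q v v = ∑ k ∈ Finset.range N, ‖(B ^ k) v‖ ^ 2 := by
    intro v
    rw [hQ]
    exact Finset.sum_congr rfl fun k _ => real_inner_self_eq_norm_sq _
  refine ⟨Q, hsymm, fun v => ?_, 1 / (4 * t), by positivity, fun v => ?_⟩
  · rw [hQv]
    have := Finset.single_le_sum (f := fun k => ‖(B ^ k) v‖ ^ 2) (fun k _ => by positivity)
      (Finset.mem_range.2 hN0)
    simpa using this
  · have hstep : Q (B v) (B v) = Q v v - ‖v‖ ^ 2 + ‖(B ^ N) v‖ ^ 2 := by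
      rw [hQv, hQv]
      have h1 : ∀ k, (B ^ k) (B v) = (B ^ (k + 1)) v := fun k => by
        rw [pow_succ]; rfl
      simp_rw [h1]
      have h2 := Finset.sum_range_succ (fun k => ‖(B ^ k) v‖ ^ 2) N
      rw [Finset.sum_range_succ'] at h2
      simp only [pow_zero, one_apply_eq_self] at h2
      linarith
    have hBN : ‖(B ^ N) v‖ ^ 2 ≤ 1 / 4 * ‖v‖ ^ 2 := by
      have h1 : ‖(B ^ N) v‖ ≤ 1 / 2 * ‖v‖ :=
        ((B ^ N).le_opNorm v).trans (mul_le_mul_of_nonneg_right hN.le (norm_nonneg _))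
      nlinarith [norm_nonneg ((B ^ N) v), norm_nonneg v]
    -- Positivity of `Q` turns the decrease over one Euler step into a bound on `Q v (A v)`: it
    -- gives `2 t Q v (A v) ≤ Q (B v) (B v) - Q v v ≤ -(3/4) ‖v‖²`.
    have hpos : 0 ≤ Q (v - B v) (v - B v) := by
      rw [hQv]
      exact Finset.sum_nonneg fun k _ => by positivity
    have hexp : Q (v - B v) (v - B v) = Q v v - 2 * Q v (B v) + Q (B v) (B v) := by
      simp only [map_sub, sub_apply]
      rw [hsymm (B v) v]
      ring
    have hBv : Q v (B v) = Q v v + t * Q v (A v) := by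
      simp [hB]
    have : t * Q v (A v) ≤ -(1 / 4) * ‖v‖ ^ 2 := by
      nlinarith [sq_nonneg ‖v‖]
    have h3 : Q v (A v) ≤ (-(1 / 4) * ‖v‖ ^ 2) / t := by
      rw [le_div_iff₀ ht]; linarith
    calc Q v (A v) ≤ (-(1 / 4) * ‖v‖ ^ 2) / t := h3
      _ = -(1 / (4 * t)) * ‖v‖ ^ 2 := by field_simp

end Lyapunov
-- Local structure of equilibria near a linearly stable one.
section Local

variable {n : ℕ} {f : State n → ℝ → State n}

theorem hasFDerivAt_state (hf : ContDiff ℝ 2 (fun p : State n × ℝ => f p.1 p.2)) (x : State n)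
    (l : ℝ) : HasFDerivAt (fun y => f y l)
      ((fderiv ℝ (fun p : State n × ℝ => f p.1 p.2) (x, l)).comp
        (ContinuousLinearMap.inl ℝ (State n) ℝ)) x := by
  have h1 := ((hf.differentiable (by norm_num)) (x, l)).hasFDerivAt
  exact HasFDerivAt.comp (f := fun y : State n => (y, l)) x h1
    ((hasFDerivAt_id x).prodMk (hasFDerivAt_const l x))

theorem toEuclideanCLM_jacobian (x : State n) (l : ℝ) :
    Matrix.toEuclideanCLM (𝕜 := ℝ) (jacobian f x l) = fderiv ℝ (fun y => f y l) x := by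
  set A := fderiv ℝ (fun y => f y l) x with hA
  ext v i
  conv_rhs => rw [show v = ∑ j, v j • EuclideanSpace.single j (1 : ℝ) by
    ext k; simp [Finset.sum_apply, Pi.single_apply]]
  rw [map_sum]
  simp only [Matrix.ofLp_toEuclideanCLM, Matrix.mulVec, dotProduct, jacobian, map_smul,
    WithLp.ofLp_sum, Finset.sum_apply, WithLp.ofLp_smul, Pi.smul_apply, smul_eq_mul]
  exact Finset.sum_congr rfl fun j _ => mul_comm _ _

theorem continuous_jacobian (hf : ContDiff ℝ 2 (fun p : State n × ℝ => f p.1 p.2)) :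
    Continuous fun p : State n × ℝ => jacobian f p.1 p.2 := by
  have h1 : Continuous (fderiv ℝ (fun p : State n × ℝ => f p.1 p.2)) :=
    hf.continuous_fderiv (by norm_num)
  refine continuous_matrix fun i j => ?_
  have h2 : (fun p : State n × ℝ => jacobian f p.1 p.2 i j) = fun p : State n × ℝ =>
      fderiv ℝ (fun p : State n × ℝ => f p.1 p.2) p (EuclideanSpace.single j 1, 0) i := by
    funext p
    simp [jacobian, (hasFDerivAt_state hf p.1 p.2).fderiv]
  rw [h2]
  have h3 := h1.clm_apply (continuous_const (y := ((EuclideanSpace.single j 1, 0) : State n × ℝ)))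
  exact (EuclideanSpace.proj (𝕜 := ℝ) i).continuous.comp h3

theorem eventually_hurwitz (hf : ContDiff ℝ 2 (fun p : State n × ℝ => f p.1 p.2))
    {p₀ : State n × ℝ} (h : ∀ z ∈ jacSpectrum f p₀.1 p₀.2, z.re < 0) :
    ∀ᶠ p in 𝓝 p₀, ∀ z ∈ jacSpectrum f p.1 p.2, z.re < 0 :=
  (isOpen_setOf_hurwitz.preimage (continuous_jacobian hf)).mem_nhds h

theorem isClosed_equilibria (hf : ContDiff ℝ 2 (fun p : State n × ℝ => f p.1 p.2)) (a b : ℝ) :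
    IsClosed (equilibria f a b) :=
  (isClosed_eq hf.continuous continuous_const).inter
    ((isClosed_le continuous_const continuous_snd).inter
      (isClosed_le continuous_snd continuous_const))

/-- A limit of linearly stable equilibria is linearly stable or a bifurcation equilibrium. -/
theorem mem_stabSet_or_mem_bifSet (hf : ContDiff ℝ 2 (fun p : State n × ℝ => f p.1 p.2))
    {a b : ℝ} {p : State n × ℝ} (hp : p ∈ closure (stabSet f a b)) :
    p ∈ stabSet f a b ∨ p ∈ bifSet f a b := by
  have hsub : stabSet f a b ⊆ equilibria f a b ∩
      {p | ∀ z ∈ jacSpectrum f p.1 p.2, z.re ≤ 0} :=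
    fun q hq => ⟨hq.1, fun z hz => (hq.2 z hz).le⟩
  have hcl := closure_minimal hsub ((isClosed_equilibria hf a b).inter
    (isClosed_setOf_spectrum_re_nonpos.preimage (continuous_jacobian hf)))
  obtain ⟨h1, h2⟩ := hcl hp
  by_cases h : ∃ z ∈ jacSpectrum f p.1 p.2, z.re = 0
  · refine Or.inr ⟨h1, h, ?_⟩
    rintro _ ⟨z, hz, rfl⟩
    exact h2 z hz
  · push Not at h
    exact Or.inl ⟨h1, fun z hz => lt_of_le_of_ne (h2 z hz) (h z hz)⟩

theorem disjoint_stabSet_bifSet {a b : ℝ} : Disjoint (stabSet f a b) (bifSet f a b) := by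
  rw [Set.disjoint_left]
  rintro p hp ⟨-, ⟨z, hz, hz0⟩, -⟩
  exact (hp.2 z hz).ne hz0

/-- `Matrix.toEuclideanCLM` is a continuous algebra isomorphism, so it carries the convergent powers
of the Euler step from matrices to operators. -/
theorem exists_lyapunov_form_fderiv {x₀ : State n} {l₀ : ℝ}
    (h : ∀ z ∈ jacSpectrum f x₀ l₀, z.re < 0) :
    ∃ Q : State n →L[ℝ] State n →L[ℝ] ℝ, (∀ v w, Q v w = Q w v) ∧ (∀ v, ‖v‖ ^ 2 ≤ Q v v) ∧
      ∃ c > 0, ∀ v, Q v (fderiv ℝ (fun y => f y l₀) x₀ v) ≤ -c * ‖v‖ ^ 2 := by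
  obtain ⟨t, ht, hlim⟩ := exists_tendsto_one_add_smul_pow (jacobian f x₀ l₀) h
  refine exists_lyapunov_form _ ht ?_
  have hcont : Continuous (Matrix.toEuclideanCLM (n := Fin n) (𝕜 := ℝ)) :=
    LinearMap.continuous_of_finiteDimensional
      ((Matrix.toEuclideanCLM (n := Fin n) (𝕜 := ℝ)).toAlgEquiv.toLinearMap)
  have := (hcont.tendsto 0).comp hlim
  rw [map_zero] at this
  refine this.congr fun k => ?_
  simp only [Function.comp_apply]
  rw [map_pow, map_add, map_one, map_smul, toEuclideanCLM_jacobian]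

/-- Near a linearly stable equilibrium, `f(·, l)` is strictly one-sided Lipschitz with negative
constant for a suitable inner product. -/
theorem exists_one_sided_lipschitz (hf : ContDiff ℝ 2 (fun p : State n × ℝ => f p.1 p.2))
    {x₀ : State n} {l₀ : ℝ} (h : ∀ z ∈ jacSpectrum f x₀ l₀, z.re < 0) :
    ∃ Q : State n →L[ℝ] State n →L[ℝ] ℝ, (∀ v w, Q v w = Q w v) ∧ (∀ v, ‖v‖ ^ 2 ≤ Q v v) ∧
      ∃ c > 0, ∃ ρ > 0, ∀ x y l, dist x x₀ < ρ → dist y x₀ < ρ → dist l l₀ < ρ →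
        Q (x - y) (f x l - f y l) ≤ -c * ‖x - y‖ ^ 2 := by
  obtain ⟨Q, hsymm, hpos, c, hc, hQ⟩ := exists_lyapunov_form_fderiv h
  refine ⟨Q, hsymm, hpos, c / 2, by positivity, ?_⟩
  have hε : 0 < c / (2 * (‖Q‖ + 1)) := by positivity
  -- Strict differentiability compares two moving points `(x, l)` and `(y, l)` with the derivative
  -- at the fixed base point; the error is small enough to cost only half of `c`.
  have hstrict := (hf.contDiffAt (x := (x₀, l₀))).hasStrictFDerivAt (by norm_num)
  have hev := hstrict.isLittleO.def hε
  obtain ⟨ρ, hρ, hball⟩ := Metric.eventually_nhds_iff.1 hev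
  refine ⟨ρ, hρ, fun x y l hx hy hl => ?_⟩
  have hlt : dist (((x, l), (y, l)) : (State n × ℝ) × (State n × ℝ)) ((x₀, l₀), (x₀, l₀)) < ρ := by
    simp only [Prod.dist_eq, max_lt_iff]
    exact ⟨⟨hx, hl⟩, hy, hl⟩
  have h1 := hball hlt
  set w := x - y with hw
  have hpair : ((x, l) - (y, l) : State n × ℝ) = (w, 0) := by simp [hw]
  have hA : fderiv ℝ (fun p : State n × ℝ => f p.1 p.2) (x₀, l₀) (w, 0) =
      fderiv ℝ (fun y => f y l₀) x₀ w := by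
    rw [(hasFDerivAt_state hf x₀ l₀).fderiv]
    simp
  simp only [hpair, hA] at h1
  have hnorm : ‖((w, 0) : State n × ℝ)‖ = ‖w‖ := by simp [Prod.norm_def]
  rw [hnorm] at h1
  set e := f x l - f y l - fderiv ℝ (fun y => f y l₀) x₀ w with he
  have hsum : f x l - f y l = fderiv ℝ (fun y => f y l₀) x₀ w + e := by rw [he]; abel
  rw [hsum, map_add]
  have h2 : Q w e ≤ ‖Q‖ * ‖w‖ * ‖e‖ := (le_abs_self _).trans (Q.le_opNorm₂ w e)
  have h3 : ‖Q‖ * ‖w‖ * ‖e‖ ≤ ‖Q‖ * ‖w‖ * (c / (2 * (‖Q‖ + 1)) * ‖w‖) :=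
    mul_le_mul_of_nonneg_left h1 (by positivity)
  have h4 : ‖Q‖ * (c / (2 * (‖Q‖ + 1))) ≤ c / 2 := by
    rw [← mul_div_assoc, div_le_div_iff₀ (by positivity) (by norm_num)]
    nlinarith [norm_nonneg Q]
  have h5 : ‖Q‖ * ‖w‖ * (c / (2 * (‖Q‖ + 1)) * ‖w‖) ≤ c / 2 * ‖w‖ ^ 2 := by
    calc _ = ‖Q‖ * (c / (2 * (‖Q‖ + 1))) * ‖w‖ ^ 2 := by ring
      _ ≤ _ := mul_le_mul_of_nonneg_right h4 (by positivity)
  linarith [hQ w]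

/-- The equilibria near a linearly stable one form a `C²` curve. -/
theorem exists_equilibrium_curve (hf : ContDiff ℝ 2 (fun p : State n × ℝ => f p.1 p.2))
    {x₀ : State n} {l₀ : ℝ} (h0 : f x₀ l₀ = 0) (h : ∀ z ∈ jacSpectrum f x₀ l₀, z.re < 0) :
    ∃ Y : ℝ → State n, ContDiffAt ℝ 2 Y l₀ ∧ Y l₀ = x₀ ∧ (∀ᶠ l in 𝓝 l₀, f (Y l) l = 0) ∧
      ∀ᶠ p in 𝓝 (x₀, l₀), f p.1 p.2 = 0 → p.1 = Y p.2 := by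
  obtain ⟨Q, -, -, c, hc, hQ⟩ := exists_lyapunov_form_fderiv h
  set A := fderiv ℝ (fun y => f y l₀) x₀ with hA
  -- The Lyapunov inequality forces the kernel of `A` to vanish, which is the invertibility needed
  -- by the implicit function theorem.
  have hinj : Function.Injective A := by
    rw [injective_iff_map_eq_zero]
    intro v hv
    have := hQ v
    rw [hv, map_zero] at this
    have h2 : ‖v‖ ^ 2 ≤ 0 := by nlinarith [sq_nonneg ‖v‖]
    exact norm_eq_zero.1 (pow_eq_zero_iff (two_ne_zero) |>.1 (le_antisymm h2 (sq_nonneg _)))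
  have hG : ContDiff ℝ 2 (fun p : ℝ × State n => f p.2 p.1) :=
    hf.comp (contDiff_snd.prodMk contDiff_fst)
  have hGA : fderiv ℝ (fun p : ℝ × State n => f p.2 p.1) (l₀, x₀) ∘L
      ContinuousLinearMap.inr ℝ ℝ (State n) = A := by
    have h1 := ((hG.differentiable (by norm_num)) (l₀, x₀)).hasFDerivAt
    have h2 : HasFDerivAt (fun y => f y l₀) (fderiv ℝ (fun p : ℝ × State n => f p.2 p.1) (l₀, x₀) ∘L
      ContinuousLinearMap.inr ℝ ℝ (State n)) x₀ :=
      h1.comp x₀ ((hasFDerivAt_const l₀ x₀).prodMk (hasFDerivAt_id x₀))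
    exact h2.fderiv.symm
  have hinv : (fderiv ℝ (fun p : ℝ × State n => f p.2 p.1) (l₀, x₀) ∘L
      ContinuousLinearMap.inr ℝ ℝ (State n)).IsInvertible := by
    rw [hGA]
    exact ⟨(LinearEquiv.ofInjectiveEndo A.toLinearMap hinj).toContinuousLinearEquiv, by ext; rfl⟩
  have hcd := hG.contDiffAt (x := (l₀, x₀))
  refine ⟨hcd.implicitFunction (by norm_num) hinv, hcd.contDiffAt_implicitFunction _ hinv,
    hcd.implicitFunction_apply_self _ hinv, ?_, ?_⟩
  · have := hcd.eventually_apply_implicitFunction (by norm_num) hinv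
    simpa [h0] using this
  · have := hcd.eventually_apply_eq_iff_implicitFunction (by norm_num) hinv
    have hswap : Tendsto (Prod.swap : State n × ℝ → ℝ × State n) (𝓝 (x₀, l₀)) (𝓝 (l₀, x₀)) :=
      continuous_swap.tendsto _
    filter_upwards [hswap.eventually this] with p hp hp0
    simp only [Prod.snd_swap, Prod.fst_swap, h0] at hp
    exact (hp.1 hp0).symm

variable {x₀ : State n} {l₀ : ℝ} {s : Set ℝ} {X Y : ℝ → State n}

theorem eventually_eq_of_equilibrium (hf : ContDiff ℝ 2 (fun p : State n × ℝ => f p.1 p.2))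
    (h0 : f x₀ l₀ = 0) (h : ∀ z ∈ jacSpectrum f x₀ l₀, z.re < 0) :
    ∀ᶠ x in 𝓝 x₀, f x l₀ = 0 → x = x₀ := by
  obtain ⟨Z, -, hZ0, -, hZ⟩ := exists_equilibrium_curve hf h0 h
  have : Tendsto (fun x : State n => (x, l₀)) (𝓝 x₀) (𝓝 (x₀, l₀)) :=
    (Continuous.prodMk_left l₀).tendsto x₀
  filter_upwards [this.eventually hZ] with x hx hx0
  rw [hx hx0, hZ0]

/-- Both curves must coincide locally with the implicit function through their common point. The
version within `s` also covers end points of intervals. -/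
theorem eventuallyEq_of_equilibria (hf : ContDiff ℝ 2 (fun p : State n × ℝ => f p.1 p.2))
    (h : ∀ z ∈ jacSpectrum f (X l₀) l₀, z.re < 0) (hl : f (X l₀) l₀ = 0)
    (hX : ContinuousWithinAt X s l₀) (hX0 : ∀ l ∈ s, f (X l) l = 0)
    (hY : ContinuousWithinAt Y s l₀) (hY0 : ∀ᶠ l in 𝓝[s] l₀, f (Y l) l = 0) (hXY : X l₀ = Y l₀) :
    X =ᶠ[𝓝[s] l₀] Y := by
  obtain ⟨Z, -, -, -, hZ⟩ := exists_equilibrium_curve hf hl h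
  have h1 : Tendsto (fun l => (X l, l)) (𝓝[s] l₀) (𝓝 (X l₀, l₀)) :=
    hX.prodMk_nhds continuousWithinAt_id
  have h2 : Tendsto (fun l => (Y l, l)) (𝓝[s] l₀) (𝓝 (X l₀, l₀)) := by
    rw [hXY]
    exact hY.prodMk_nhds continuousWithinAt_id
  filter_upwards [h1.eventually hZ, h2.eventually hZ, self_mem_nhdsWithin, hY0] with l h3 h4 hl hl'
  rw [h3 (hX0 l hl), h4 hl']

theorem contDiffWithinAt_of_equilibria (hf : ContDiff ℝ 2 (fun p : State n × ℝ => f p.1 p.2))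
    (hl₀ : l₀ ∈ s) (h : ∀ z ∈ jacSpectrum f (X l₀) l₀, z.re < 0)
    (hX : ContinuousWithinAt X s l₀) (hX0 : ∀ l ∈ s, f (X l) l = 0) :
    ContDiffWithinAt ℝ 2 X s l₀ := by
  obtain ⟨Z, hZ, hZ0, hZe, -⟩ := exists_equilibrium_curve hf (hX0 l₀ hl₀) h
  have := eventuallyEq_of_equilibria hf h (hX0 l₀ hl₀) hX hX0 hZ.continuousAt.continuousWithinAt
    (hZe.filter_mono nhdsWithin_le_nhds) hZ0.symm
  exact hZ.contDiffWithinAt.congr_of_eventuallyEq this hZ0.symm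

end Local
-- Continuation of the stable branch.
section Continuation

/-- A bounded curve on `[a, d)` that has an isolated cluster point at `d` converges to it. -/
theorem tendsto_of_isolated_mapClusterPt {E : Type*} [MetricSpace E] [ProperSpace E] {a d : ℝ}
    (had : a < d) {X : ℝ → E} (hX : ContinuousOn X (Ico a d)) {p : E}
    (hp : MapClusterPt p (𝓝[<] d) X)
    (hiso : ∀ᶠ q in 𝓝 p, MapClusterPt q (𝓝[<] d) X → q = p) : Tendsto X (𝓝[<] d) (𝓝 p) := by
  obtain ⟨ρ, hρ, hball⟩ := Metric.eventually_nhds_iff.1 hiso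
  rw [Metric.tendsto_nhds]
  intro ε hε
  by_contra hcon
  set δ := min ε (ρ / 2) with hδ
  have hδ0 : 0 < δ := lt_min hε (by positivity)
  have hδρ : δ < ρ := (min_le_right _ _).trans_lt (by linarith)
  have hfar : ∃ᶠ l in 𝓝[<] d, δ ≤ dist (X l) p :=
    (not_eventually.1 hcon).mono fun l hl => (min_le_left _ _).trans (not_lt.1 hl)
  have hnear : ∃ᶠ l in 𝓝[<] d, dist (X l) p < δ := hp.frequently (Metric.ball_mem_nhds p hδ0)
  -- Without convergence the curve is both near and far from `p` arbitrarily close to `d`, so it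
  -- crosses the sphere by the intermediate value theorem. Compactness of the sphere then yields a
  -- second cluster point inside the isolating ball.
  have hsphere : ∃ᶠ l in 𝓝[<] d, X l ∈ Metric.sphere p δ := by
    rw [frequently_iff]
    intro U hU
    obtain ⟨c, hc, hcU⟩ := (mem_nhdsLT_iff_exists_Ioo_subset' had).1 hU
    have hI : Ioo (max a c) d ∈ 𝓝[<] d := Ioo_mem_nhdsLT (max_lt had hc)
    obtain ⟨l₁, hl₁, h₁⟩ := (hfar.and_eventually hI).exists
    obtain ⟨l₂, hl₂, h₂⟩ := (hnear.and_eventually hI).exists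
    have hsub : uIcc l₂ l₁ ⊆ Ioo (max a c) d := ordConnected_Ioo.uIcc_subset h₂ h₁
    have hcont : ContinuousOn (fun l => dist (X l) p) (uIcc l₂ l₁) :=
      (continuous_id.dist continuous_const).comp_continuousOn
        (hX.mono fun l hl => ⟨((le_max_left _ _).trans_lt (hsub hl).1).le, (hsub hl).2⟩)
    obtain ⟨l, hl, hl'⟩ := intermediate_value_uIcc hcont
      (show δ ∈ uIcc (dist (X l₂) p) (dist (X l₁) p) from Icc_subset_uIcc ⟨hl₂.le, hl₁⟩)
    exact ⟨l, hcU ⟨(le_max_right _ _).trans_lt (hsub hl).1, (hsub hl).2⟩, hl'⟩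
  obtain ⟨q, hq, hqc⟩ := (isCompact_sphere p δ).exists_mapClusterPt_of_frequently hsphere
  have hqp : dist q p = δ := hq
  have := hball (by rw [hqp]; exact hδρ) hqc
  rw [this, dist_self] at hqp
  exact hδ0.ne hqp

variable {n : ℕ} {f : State n → ℝ → State n} {a b d : ℝ} {X Y : ℝ → State n} {Xm : State n}

/-- A continuous curve of linearly stable equilibria over `[a, d]` that starts at `Xm`. -/
structure IsStabCurve (f : State n → ℝ → State n) (a b : ℝ) (Xm : State n) (d : ℝ)
    (X : ℝ → State n) : Prop where
  continuousOn : ContinuousOn X (Icc a d)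
  mem_stabSet : ∀ l ∈ Icc a d, (X l, l) ∈ stabSet f a b
  start : X a = Xm

theorem IsStabCurve.mono {d' : ℝ} (hX : IsStabCurve f a b Xm d X) (h : d' ≤ d) :
    IsStabCurve f a b Xm d' X :=
  ⟨hX.continuousOn.mono (Icc_subset_Icc_right h),
    fun l hl => hX.mem_stabSet l (Icc_subset_Icc_right h hl), hX.start⟩

/-- The agreement set is closed, contains `a`, and propagates to the right by local uniqueness. -/
theorem IsStabCurve.eqOn (hf : ContDiff ℝ 2 (fun p : State n × ℝ => f p.1 p.2))
    (hX : IsStabCurve f a b Xm d X) (hY : IsStabCurve f a b Xm d Y) : EqOn X Y (Icc a d) := by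
  have hcl : IsClosed ({l | X l = Y l} ∩ Icc a d) := by
    have := (hX.continuousOn.prodMk hY.continuousOn).preimage_isClosed_of_isClosed isClosed_Icc
      (isClosed_diagonal (X := State n))
    rwa [inter_comm] at this
  refine hcl.Icc_subset_of_forall_mem_nhdsWithin (hX.start.trans hY.start.symm) ?_
  rintro l ⟨hl, hlI⟩
  have hlI' : l ∈ Icc a d := Ico_subset_Icc_self hlI
  have h1 := eventuallyEq_of_equilibria hf (hX.mem_stabSet l hlI').2 (hX.mem_stabSet l hlI').1.1
    (hX.continuousOn l hlI') (fun m hm => (hX.mem_stabSet m hm).1.1) (hY.continuousOn l hlI')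
    (eventually_of_mem self_mem_nhdsWithin fun m hm => (hY.mem_stabSet m hm).1.1) hl
  have h2 : Icc a d ∈ 𝓝[>] l := mem_of_superset (Ioo_mem_nhdsGT hlI.2)
    fun m hm => ⟨hlI.1.trans hm.1.le, hm.2.le⟩
  rw [EventuallyEq, Filter.Eventually, nhdsWithin] at h1
  exact (nhdsWithin_le_of_mem h2) h1

theorem IsStabCurve.exists_extension (hf : ContDiff ℝ 2 (fun p : State n × ℝ => f p.1 p.2))
    (hX : IsStabCurve f a b Xm d X) (had : a ≤ d) (hdb : d < b) :
    ∃ d' Y, d < d' ∧ d' ≤ b ∧ IsStabCurve f a b Xm d' Y := by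
  have hd := hX.mem_stabSet d (right_mem_Icc.2 had)
  obtain ⟨Z, hZ, hZ0, hZe, -⟩ := exists_equilibrium_curve (x₀ := X d) (l₀ := d) hf hd.1.1 hd.2
  have hZcont : ∀ᶠ l in 𝓝 d, ContinuousAt Z l :=
    (hZ.eventually (by norm_num)).mono fun l hl => hl.continuousAt
  have hZp : Tendsto (fun l => (Z l, l)) (𝓝 d) (𝓝 (X d, d)) := by
    rw [← hZ0]
    exact hZ.continuousAt.prodMk continuousAt_id
  have hZs := hZp.eventually (eventually_hurwitz hf (p₀ := (X d, d)) hd.2)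
  obtain ⟨ε, hε, hball⟩ := Metric.eventually_nhds_iff.1 (hZcont.and (hZe.and hZs))
  set d' := min (d + ε / 2) b with hd'
  have hdd' : d < d' := lt_min (by linarith) hdb
  have hmem : ∀ l ∈ Icc d d', dist l d < ε := by
    intro l hl
    rw [Real.dist_eq, abs_of_nonneg (by linarith [hl.1])]
    have := hl.2.trans (min_le_left _ _)
    linarith
  have hIcc : Icc a d' = Icc a d ∪ Icc d d' := (Icc_union_Icc_eq_Icc had hdd'.le).symm
  let W : ℝ → State n := fun l => if l ≤ d then X l else Z l
  have hW1 : EqOn W X (Icc a d) := fun l hl => if_pos hl.2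
  have hW2 : EqOn W Z (Icc d d') := by
    intro l hl
    rcases hl.1.eq_or_lt with h | h
    · subst h
      simp [W, hZ0]
    · exact if_neg (not_le.2 h)
  refine ⟨d', W, hdd', min_le_right _ _, ?_, ?_, (hW1 (left_mem_Icc.2 had)).trans hX.start⟩
  · rw [hIcc]
    refine ContinuousOn.union_of_isClosed (hX.continuousOn.congr hW1) ?_ isClosed_Icc isClosed_Icc
    exact ContinuousOn.congr
      (fun l hl => (hball (hmem l hl)).1.continuousWithinAt) hW2
  · intro l hl
    rw [hIcc] at hl
    rcases hl with hl | hl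
    · rw [hW1 hl]
      exact hX.mem_stabSet l hl
    · rw [hW2 hl]
      obtain ⟨-, h1, h2⟩ := hball (hmem l hl)
      exact ⟨⟨h1, had.trans hl.1, hl.2.trans (min_le_right _ _)⟩, h2⟩

/-- A continuous curve over `[a, d]` whose points are linearly stable equilibria, except possibly at
`d`, where it may be only a limit of such equilibria, is a stable branch. -/
theorem isStableBranch_of_mem_closure (hf : ContDiff ℝ 2 (fun p : State n × ℝ => f p.1 p.2))
    (had : a < d) (hX : ContinuousOn X (Icc a d))
    (hs : ∀ l ∈ Ico a d, (X l, l) ∈ stabSet f a b) (hd : (X d, d) ∈ closure (stabSet f a b)) :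
    IsStableBranch f a b a d X := by
  have hcl : ∀ l ∈ Icc a d, (X l, l) ∈ closure (stabSet f a b) := by
    intro l hl
    rcases hl.2.eq_or_lt with h | h
    · rw [h]
      exact hd
    · exact subset_closure (hs l ⟨hl.1, h⟩)
  have heq : ∀ l ∈ Icc a d, (X l, l) ∈ equilibria f a b := fun l hl =>
    closure_minimal (fun q hq => hq.1) (isClosed_equilibria hf a b) (hcl l hl)
  exact
    { lt := had
      continuousOn := hX
      contDiffOn := by
        rintro l ⟨hl, hlb⟩
        have hst := (mem_stabSet_or_mem_bifSet hf (hcl l hl)).resolve_right hlb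
        exact (contDiffWithinAt_of_equilibria hf hl hst.2 (hX l hl)
          fun m hm => (heq m hm).1).mono fun m hm => hm.1
      mem_equilibria := heq
      notMem_bif := fun l hl =>
        disjoint_stabSet_bifSet.notMem_of_mem_left (hs l (Ioo_subset_Ico_self hl))
      mem_closure := hcl }

theorem IsStabCurve.mem_stableBranchFrom (hf : ContDiff ℝ 2 (fun p : State n × ℝ => f p.1 p.2))
    (hX : IsStabCurve f a b Xm d X) (had : a < d) {l : ℝ} (hl : l ∈ Icc a d) :
    (X l, l) ∈ stableBranchFrom f a b Xm :=
  ⟨d, X, isStableBranch_of_mem_closure hf had hX.continuousOn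
    (fun m hm => hX.mem_stabSet m (Ico_subset_Icc_self hm))
    (subset_closure (hX.mem_stabSet d (right_mem_Icc.2 had.le))), hX.start, hl, rfl⟩

theorem mem_closure_stabSet_of_mapClusterPt (had : a < d)
    (hs : ∀ l ∈ Ico a d, (X l, l) ∈ stabSet f a b) {q : State n}
    (hq : MapClusterPt q (𝓝[<] d) X) : (q, d) ∈ closure (stabSet f a b) := by
  rw [Metric.mem_closure_iff]
  intro ε hε
  have h1 : ∃ᶠ l in 𝓝[<] d, dist (X l) q < ε := hq.frequently (Metric.ball_mem_nhds q hε)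
  have h2 : ∀ᶠ l in 𝓝[<] d, dist l d < ε :=
    nhdsWithin_le_nhds (Metric.ball_mem_nhds d hε)
  obtain ⟨l, ⟨hl1, hl2⟩, hl3⟩ :=
    ((h1.and_eventually h2).and_eventually (Ico_mem_nhdsLT had)).exists
  refine ⟨(X l, l), hs l hl3, ?_⟩
  rw [dist_comm, Prod.dist_eq]
  exact max_lt hl1 hl2

/-- A bounded curve of linearly stable equilibria over `[a, d)` converges at `d`. -/
theorem exists_tendsto_of_isBounded (hf : ContDiff ℝ 2 (fun p : State n × ℝ => f p.1 p.2))
    (hreg : ∀ p : State n × ℝ, ¬ AccPt p (𝓟 (bifSet f a b))) (had : a < d)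
    (hX : ContinuousOn X (Ico a d)) (hs : ∀ l ∈ Ico a d, (X l, l) ∈ stabSet f a b)
    (hbdd : Bornology.IsBounded (X '' Ico a d)) :
    ∃ p, Tendsto X (𝓝[<] d) (𝓝 p) ∧ (p, d) ∈ closure (stabSet f a b) := by
  have hcl := fun q => mem_closure_stabSet_of_mapClusterPt (q := q) had hs
  suffices ∃ p, MapClusterPt p (𝓝[<] d) X ∧
      ∀ᶠ q in 𝓝 p, MapClusterPt q (𝓝[<] d) X → q = p by
    obtain ⟨p, hp, hiso⟩ := this
    exact ⟨p, tendsto_of_isolated_mapClusterPt had hX hp hiso, hcl p hp⟩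
  by_cases hst : ∃ p, MapClusterPt p (𝓝[<] d) X ∧ (p, d) ∈ stabSet f a b
  -- One stable cluster point suffices: it is isolated among the equilibria at parameter `d`.
  -- Otherwise all cluster points are bifurcation points, and these do not accumulate.
  · obtain ⟨p, hp, hps⟩ := hst
    refine ⟨p, hp, ?_⟩
    filter_upwards [eventually_eq_of_equilibrium hf hps.1.1 hps.2] with q hq hqc
    exact hq (closure_minimal (fun q hq => hq.1) (isClosed_equilibria hf a b) (hcl q hqc)).1
  · have hbif : ∀ q, MapClusterPt q (𝓝[<] d) X → (q, d) ∈ bifSet f a b := fun q hq =>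
      (mem_stabSet_or_mem_bifSet hf (hcl q hq)).resolve_left fun h => hst ⟨q, hq, h⟩
    obtain ⟨p, -, hp⟩ := hbdd.isCompact_closure.exists_mapClusterPt_of_frequently
      (l := 𝓝[<] d) (f := X) (Eventually.frequently (eventually_of_mem (Ico_mem_nhdsLT had)
        fun l hl => subset_closure (mem_image_of_mem X hl)))
    refine ⟨p, hp, ?_⟩
    have h1 := hreg (p, d)
    rw [accPt_iff_frequently, not_frequently] at h1
    have : Tendsto (fun x : State n => (x, d)) (𝓝 p) (𝓝 (p, d)) :=
      (Continuous.prodMk_left d).tendsto p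
    filter_upwards [this.eventually h1] with q hq hqc
    by_contra hne
    exact hq ⟨fun h => hne (Prod.ext_iff.1 h).1, hbif q hqc⟩

/-- The stable branch that starts at `Xm` meets a bifurcation point, or extends over `[a, b]`. -/
theorem exists_mem_bifSet_or_isStabCurve
    (hf : ContDiff ℝ 2 (fun p : State n × ℝ => f p.1 p.2)) (hab : a ≤ b)
    (hreg : ∀ p : State n × ℝ, ¬ AccPt p (𝓟 (bifSet f a b)))
    (hm : (Xm, a) ∈ stabSet f a b) (hbdd : Bornology.IsBounded (stableBranchFrom f a b Xm)) :
    (∃ p ∈ stableBranchFrom f a b Xm, p ∈ bifSet f a b) ∨ ∃ X, IsStabCurve f a b Xm b X := by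
  rw [or_iff_not_imp_left]
  intro hbif
  set D := {d | d ∈ Icc a b ∧ ∃ X, IsStabCurve f a b Xm d X} with hD
  have haD : a ∈ D := by
    refine ⟨left_mem_Icc.2 hab, fun _ => Xm, continuousOn_const, fun l hl => ?_, rfl⟩
    rw [Icc_self] at hl
    rw [mem_singleton_iff.1 hl]
    exact hm
  have hDb : BddAbove D := ⟨b, fun d hd => hd.1.2⟩
  set e := sSup D with he
  have hae : a ≤ e := le_csSup hDb haD
  have heb : e ≤ b := csSup_le ⟨a, haD⟩ fun d hd => hd.1.2
  have hlt : ∀ l, l < e → ∃ X, IsStabCurve f a b Xm l X := by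
    intro l hl
    obtain ⟨d, hd, hld⟩ := exists_lt_of_lt_csSup ⟨a, haD⟩ hl
    obtain ⟨X, hX⟩ := hd.2
    exact ⟨X, hX.mono hld.le⟩
  have heD : ∃ X, IsStabCurve f a b Xm e X := by
    rcases hae.eq_or_lt with h | hae'
    · rw [← h]
      exact haD.2
    choose! g hg using hlt
    -- By uniqueness the curves `g m` agree where they overlap, so their diagonal is a single curve
    -- over `[a, e)`.
    set X : ℝ → State n := fun l => g l l with hXdef
    have hXg : ∀ m < e, EqOn X (g m) (Icc a m) := by
      intro m hm l hl
      exact (hg l (hl.2.trans_lt hm)).eqOn hf ((hg m hm).mono hl.2) (right_mem_Icc.2 hl.1)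
    have hmid : ∀ l ∈ Ico a e, ∃ m, l < m ∧ m < e := fun l hl => exists_between hl.2
    have hXc : ContinuousOn X (Ico a e) := by
      intro l hl
      obtain ⟨m, hlm, hme⟩ := hmid l hl
      have h1 : ContinuousWithinAt X (Icc a m) l :=
        ((hg m hme).continuousOn.congr (hXg m hme)) l ⟨hl.1, hlm.le⟩
      refine h1.mono_of_mem_nhdsWithin ?_
      filter_upwards [self_mem_nhdsWithin, nhdsWithin_le_nhds (Iio_mem_nhds hlm)] with x hx hxm
      exact ⟨hx.1, le_of_lt hxm⟩
    have hXs : ∀ l ∈ Ico a e, (X l, l) ∈ stabSet f a b := fun l hl =>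
      (hg l hl.2).mem_stabSet l (right_mem_Icc.2 hl.1)
    have hXb : Bornology.IsBounded (X '' Ico a e) := by
      refine hbdd.image_fst.subset ?_
      rintro _ ⟨l, hl, rfl⟩
      obtain ⟨m, hlm, hme⟩ := hmid l hl
      refine ⟨(X l, l), ?_, rfl⟩
      rw [hXg m hme ⟨hl.1, hlm.le⟩]
      exact (hg m hme).mem_stableBranchFrom hf (hl.1.trans_lt hlm) ⟨hl.1, hlm.le⟩
    obtain ⟨p, hp, hpcl⟩ := exists_tendsto_of_isBounded hf hreg hae' hXc hXs hXb
    set W := Function.update X e p with hW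
    have hWX : ∀ l ∈ Ico a e, W l = X l := fun l hl => Function.update_of_ne hl.2.ne _ _
    have hWe : W e = p := Function.update_self _ _ _
    have hWc : ContinuousOn W (Icc a e) := by
      have h1 : Icc a e \ {e} = Ico a e := Icc_sdiff_right
      rw [hW, continuousOn_update_iff, h1]
      exact ⟨hXc, fun _ => hp.mono_left (nhdsWithin_mono _ Ico_subset_Iio_self)⟩
    have hWs : ∀ l ∈ Ico a e, (W l, l) ∈ stabSet f a b := fun l hl => by
      rw [hWX l hl]
      exact hXs l hl
    have hWa : W a = Xm := by
      rw [hWX a ⟨le_rfl, hae'⟩]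
      exact (hg a hae').start
    have hbranch := isStableBranch_of_mem_closure hf hae' hWc hWs (hWe.symm ▸ hpcl)
    -- The curve closed up by its limit is itself a stable branch, so a bifurcation point at the
    -- limit would lie on the branch from `Xm`.
    have hpb : (p, e) ∉ bifSet f a b := fun h => hbif
      ⟨(p, e), ⟨e, W, hbranch, hWa, right_mem_Icc.2 hae, hWe.symm⟩, h⟩
    have hps := (mem_stabSet_or_mem_bifSet hf hpcl).resolve_right hpb
    refine ⟨W, hWc, fun l hl => ?_, hWa⟩
    rcases hl.2.eq_or_lt with h | h
    · rw [h, hWe]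
      exact hps
    · exact hWs l ⟨hl.1, h⟩
  obtain ⟨X, hX⟩ := heD
  rcases heb.eq_or_lt with h | h
  · exact ⟨X, h ▸ hX⟩
  · obtain ⟨d', Y, hd', hd'b, hY⟩ := hX.exists_extension hf hae h
    exact absurd (le_csSup hDb ⟨⟨hae.trans hd'.le, hd'b⟩, Y, hY⟩) (not_le.2 hd')

end Continuation
-- Adiabatic tracking of stable curves, and exclusion of B-tipping.
section Tracking

variable {n : ℕ} {f : State n → ℝ → State n} {L : ℝ → ℝ} {Y : ℝ → State n} {K : ℝ}

/-- A barrier argument for `Q (u - Y) (u - Y)` at level `η ^ 2`: on the barrier the contraction, of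
size `c ‖u - Y‖² / r`, beats the drift of at most `‖Q‖ ‖u - Y‖ K` caused by the motion of `Y`. -/
theorem norm_sub_le_of_one_sided_lipschitz {Q : State n →L[ℝ] State n →L[ℝ] ℝ}
    (hsymm : ∀ v w, Q v w = Q w v) (hpos : ∀ v, ‖v‖ ^ 2 ≤ Q v v) {c ρ l₀ : ℝ} {x₀ : State n}
    (hc : 0 < c)
    (hQ : ∀ x y l, dist x x₀ < ρ → dist y x₀ < ρ → dist l l₀ < ρ →
      Q (x - y) (f x l - f y l) ≤ -c * ‖x - y‖ ^ 2)
    {s₀ s₁ r η : ℝ} (hs : s₀ ≤ s₁) {u Y' : ℝ → State n}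
    (hY : ∀ s ∈ Icc s₀ s₁, dist (Y s) x₀ < ρ / 2) (hL : ∀ s ∈ Icc s₀ s₁, dist (L s) l₀ < ρ)
    (hYf : ∀ s, f (Y s) (L s) = 0) (hY' : ∀ s, HasDerivAt Y (Y' s) s) (hK : ∀ s, ‖Y' s‖ ≤ K)
    (hu : ∀ s, HasDerivAt u (r⁻¹ • f (u s) (L s)) s) (hr : 0 < r) (hη : 0 < η) (hηρ : η < ρ / 2)
    (hrη : r * ((‖Q‖ + 1) ^ 2 * K) < c * η) (h0 : (‖Q‖ + 1) * ‖u s₀ - Y s₀‖ ≤ η) :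
    ‖u s₁ - Y s₁‖ ≤ η := by
  have hK0 : 0 ≤ K := (norm_nonneg _).trans (hK s₀)
  have hq := norm_nonneg Q
  have hQle : ∀ v w, Q v w ≤ ‖Q‖ * ‖v‖ * ‖w‖ := fun v w =>
    (le_abs_self _).trans (Q.le_opNorm₂ v w)
  have hw : ∀ s, HasDerivAt (fun s => u s - Y s) (r⁻¹ • f (u s) (L s) - Y' s) s := fun s =>
    (hu s).sub (hY' s)
  have hW : ∀ s, HasDerivAt (fun s => Q (u s - Y s) (u s - Y s))
      (2 * Q (u s - Y s) (r⁻¹ • f (u s) (L s) - Y' s)) s := by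
    intro s
    have h1 : HasDerivAt (fun s => Q (u s - Y s)) (Q (r⁻¹ • f (u s) (L s) - Y' s)) s :=
      Q.hasFDerivAt.comp_hasDerivAt s (hw s)
    have h2 := h1.clm_apply (hw s)
    rw [hsymm (r⁻¹ • f (u s) (L s) - Y' s)] at h2
    exact h2.congr_deriv (two_mul _).symm
  have hWle : Q (u s₁ - Y s₁) (u s₁ - Y s₁) ≤ η ^ 2 := by
    refine image_le_of_deriv_right_lt_deriv_boundary (a := s₀) (b := s₁)
      (f := fun s => Q (u s - Y s) (u s - Y s)) (B := fun _ => η ^ 2) (B' := fun _ => 0)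
      (fun s _ => (hW s).continuousAt.continuousWithinAt)
      (fun s _ => (hW s).hasDerivWithinAt) ?_ (fun s => hasDerivAt_const _ _) ?_
      (right_mem_Icc.2 hs)
    · have h1 := hQle (u s₀ - Y s₀) (u s₀ - Y s₀)
      have h2 : ((‖Q‖ + 1) * ‖u s₀ - Y s₀‖) ^ 2 ≤ η ^ 2 :=
        pow_le_pow_left₀ (by positivity) h0 2
      nlinarith [mul_nonneg (mul_nonneg hq hq) (sq_nonneg ‖u s₀ - Y s₀‖),
        mul_nonneg hq (sq_nonneg ‖u s₀ - Y s₀‖), sq_nonneg ‖u s₀ - Y s₀‖]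
    · intro s hsI hsη
      have hsI' := Ico_subset_Icc_self hsI
      set w := u s - Y s with hwdef
      have hwη : ‖w‖ ≤ η := by
        have := hpos w
        rw [hsη] at this
        exact le_of_sq_le_sq this hη.le
      have hux : dist (u s) x₀ < ρ := by
        calc dist (u s) x₀ ≤ dist (u s) (Y s) + dist (Y s) x₀ := dist_triangle _ _ _
          _ < ρ := by
            rw [dist_eq_norm]
            have := hY s hsI'
            linarith
      have hYx : dist (Y s) x₀ < ρ := by
        have := hY s hsI'
        have : 0 ≤ dist (Y s) x₀ := dist_nonneg
        linarith
      have h1 := hQ _ _ _ hux hYx (hL s hsI')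
      rw [hYf s, sub_zero] at h1
      have h2 : -Q w (Y' s) ≤ ‖Q‖ * ‖w‖ * K := by
        have := (neg_le_abs (Q w (Y' s))).trans (Q.le_opNorm₂ w (Y' s))
        exact this.trans (mul_le_mul_of_nonneg_left (hK s) (by positivity))
      -- On the barrier `η² = Q w w ≤ ‖Q‖ ‖w‖ η`, so `w` cannot be too small for the contraction to
      -- dominate.
      have hlow : η ≤ (‖Q‖ + 1) * ‖w‖ := by
        have h3 := hQle w w
        rw [hsη] at h3
        have h4 : ‖Q‖ * ‖w‖ * ‖w‖ ≤ ‖Q‖ * ‖w‖ * η := by gcongr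
        have h5 : η * η ≤ ‖Q‖ * ‖w‖ * η := by nlinarith
        have h6 := le_of_mul_le_mul_right h5 hη
        nlinarith [norm_nonneg w]
      have hw0 : 0 < ‖w‖ := by
        by_contra hcon
        have : ‖w‖ = 0 := le_antisymm (not_lt.1 hcon) (norm_nonneg w)
        rw [this, mul_zero] at hlow
        linarith
      have hkey : r * (‖Q‖ * K) < c * ‖w‖ := by
        have h3 : r * ((‖Q‖ + 1) ^ 2 * K) < c * ((‖Q‖ + 1) * ‖w‖) :=
          hrη.trans_le (mul_le_mul_of_nonneg_left hlow hc.le)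
        have h4 : (‖Q‖ + 1) * (r * ((‖Q‖ + 1) * K)) < (‖Q‖ + 1) * (c * ‖w‖) := by
          calc _ = r * ((‖Q‖ + 1) ^ 2 * K) := by ring
            _ < _ := h3
            _ = _ := by ring
        have h5 := lt_of_mul_lt_mul_left h4 (by positivity)
        have h6 : r * (‖Q‖ * K) ≤ r * ((‖Q‖ + 1) * K) := by gcongr; linarith
        exact h6.trans_lt h5
      have hneg : Q w (r⁻¹ • f (u s) (L s) - Y' s) < 0 := by
        rw [map_sub, map_smul, smul_eq_mul]
        have h3 : r⁻¹ * Q w (f (u s) (L s)) ≤ r⁻¹ * (-c * ‖w‖ ^ 2) :=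
          mul_le_mul_of_nonneg_left h1 (inv_nonneg.2 hr.le)
        have h4 : ‖Q‖ * K < r⁻¹ * (c * ‖w‖) := by
          rw [inv_mul_eq_div, lt_div_iff₀ hr]
          linarith
        have h5 : ‖Q‖ * K * ‖w‖ < r⁻¹ * (c * ‖w‖) * ‖w‖ := mul_lt_mul_of_pos_right h4 hw0
        nlinarith
      exact mul_neg_of_pos_of_neg two_pos hneg
  exact le_of_sq_le_sq ((hpos _).trans hWle) hη.le

/-- The slow-time form `r du/ds = f(u, L(s))` of the nonautonomous equation, on all of `ℝ`. -/
def IsSlowSolution (f : State n → ℝ → State n) (L : ℝ → ℝ) (r : ℝ) (u : ℝ → State n) : Prop :=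
  ∀ s, HasDerivAt u (r⁻¹ • f (u s) (L s)) s

/-- On intervals inside `I`, solutions stay near `Y` if they start near `Y`, for small rates. -/
def TracksLocally (f : State n → ℝ → State n) (L : ℝ → ℝ) (Y : ℝ → State n) (I : Set ℝ) : Prop :=
  ∀ η > 0, ∃ δ > 0, ∃ r₀ > 0, ∀ r, 0 < r → r < r₀ → ∀ u, IsSlowSolution f L r u →
    ∀ s₀ s₁, s₀ ≤ s₁ → Icc s₀ s₁ ⊆ I → ‖u s₀ - Y s₀‖ ≤ δ → ‖u s₁ - Y s₁‖ ≤ η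

/-- Solutions with past limit `Xm` are near `Y` at all times in `S`, for small rates. -/
def TracksOn (f : State n → ℝ → State n) (L : ℝ → ℝ) (Xm : State n) (Y : ℝ → State n)
    (S : Set ℝ) : Prop :=
  ∀ η > 0, ∃ r₀ > 0, ∀ r, 0 < r → r < r₀ → ∀ u, IsSlowSolution f L r u →
    Tendsto u atBot (𝓝 Xm) → ∀ s ∈ S, ‖u s - Y s‖ ≤ η

/-- The general filter `l` lets one statement serve finite times and both limits `s → ±∞`. -/
theorem exists_tracksLocally (hf : ContDiff ℝ 2 (fun p : State n × ℝ => f p.1 p.2))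
    {l : Filter ℝ} {x₀ : State n} {l₀ : ℝ} (h : ∀ z ∈ jacSpectrum f x₀ l₀, z.re < 0)
    (hYl : Tendsto Y l (𝓝 x₀)) (hLl : Tendsto L l (𝓝 l₀)) (hYf : ∀ s, f (Y s) (L s) = 0)
    (hY : ∀ s, ∃ y, HasDerivAt Y y s ∧ ‖y‖ ≤ K) : ∃ I ∈ l, TracksLocally f L Y I := by
  obtain ⟨Q, hsymm, hpos, c, hc, ρ, hρ, hQ⟩ := exists_one_sided_lipschitz hf h
  choose Y' hY' hK using hY
  have hK0 : 0 ≤ K := (norm_nonneg _).trans (hK 0)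
  refine ⟨{s | dist (Y s) x₀ < ρ / 2 ∧ dist (L s) l₀ < ρ},
    (hYl.eventually (Metric.ball_mem_nhds x₀ (half_pos hρ))).and
      (hLl.eventually (Metric.ball_mem_nhds l₀ hρ)), ?_⟩
  intro η₁ hη₁
  set η := min η₁ (ρ / 4) with hηdef
  have hη : 0 < η := lt_min hη₁ (by positivity)
  have hηρ : η < ρ / 2 := (min_le_right _ _).trans_lt (by linarith)
  -- `K + 1` keeps the denominator positive when `K = 0`.
  refine ⟨η / (‖Q‖ + 1), by positivity, c * η / ((‖Q‖ + 1) ^ 2 * (K + 1)), by positivity, ?_⟩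
  intro r hr hr₀ u hu s₀ s₁ hs hI h0
  refine (norm_sub_le_of_one_sided_lipschitz hsymm hpos hc hQ hs (fun s hs => (hI hs).1)
    (fun s hs => (hI hs).2) hYf hY' hK hu hr hη hηρ ?_ ?_).trans (min_le_left _ _)
  · rw [lt_div_iff₀ (by positivity)] at hr₀
    refine lt_of_le_of_lt ?_ hr₀
    gcongr
    linarith
  · rw [le_div_iff₀ (by positivity)] at h0
    linarith

theorem TracksOn.extend {Xm : State n} {S : ℝ} {I : Set ℝ} (h : TracksOn f L Xm Y (Iic S))
    (hI : TracksLocally f L Y I) : TracksOn f L Xm Y {s | s ≤ S ∨ Icc S s ⊆ I} := by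
  intro η hη
  obtain ⟨δ, hδ, r₁, hr₁, h₁⟩ := hI η hη
  obtain ⟨r₂, hr₂, h₂⟩ := h (min δ η) (lt_min hδ hη)
  refine ⟨min r₁ r₂, lt_min hr₁ hr₂, fun r hr hrr u hu hlim s hs => ?_⟩
  have h3 := h₂ r hr (hrr.trans_le (min_le_right _ _)) u hu hlim
  rcases le_or_gt s S with hsS | hsS
  · exact (h3 s hsS).trans (min_le_right _ _)
  · exact h₁ r hr (hrr.trans_le (min_le_left _ _)) u hu S s hsS.le
      (hs.resolve_left (not_le.2 hsS)) ((h3 S self_mem_Iic).trans (min_le_left _ _))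

/-- Solutions with past limit `Xm` track a curve of linearly stable equilibria for small rates. -/
theorem tracksOn_univ (hf : ContDiff ℝ 2 (fun p : State n × ℝ => f p.1 p.2))
    {Xm Xp : State n} {a b : ℝ} (hL : Continuous L) (hLa : Tendsto L atBot (𝓝 a))
    (hLb : Tendsto L atTop (𝓝 b)) (hYa : Tendsto Y atBot (𝓝 Xm)) (hYb : Tendsto Y atTop (𝓝 Xp))
    (hYf : ∀ s, f (Y s) (L s) = 0) (hs : ∀ s, ∀ z ∈ jacSpectrum f (Y s) (L s), z.re < 0)
    (hm : ∀ z ∈ jacSpectrum f Xm a, z.re < 0) (hp : ∀ z ∈ jacSpectrum f Xp b, z.re < 0)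
    (hY : ∀ s, ∃ y, HasDerivAt Y y s ∧ ‖y‖ ≤ K) : TracksOn f L Xm Y univ := by
  have hYc : Continuous Y := continuous_iff_continuousAt.2 fun s => (hY s).choose_spec.1.continuousAt
  -- Letting both times vary around `S` makes the set of times up to which tracking holds open and
  -- its complement open.
  have hstep : ∀ S : ℝ, ∃ ε > 0, ∀ S₁ ∈ Metric.ball S ε, ∀ S₂ ∈ Metric.ball S ε,
      TracksOn f L Xm Y (Iic S₁) → TracksOn f L Xm Y (Iic S₂) := by
    intro S
    obtain ⟨I, hI, hIt⟩ := exists_tracksLocally hf (hs S) (hYc.tendsto S) (hL.tendsto S) hYf hY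
    obtain ⟨ε, hε, hball⟩ := Metric.mem_nhds_iff.1 hI
    refine ⟨ε, hε, fun S₁ h₁ S₂ h₂ hT => ?_⟩
    intro η hη
    obtain ⟨r₀, hr₀, h⟩ := hT.extend hIt η hη
    refine ⟨r₀, hr₀, fun r hr hrr u hu hlim s hsS => h r hr hrr u hu hlim s ?_⟩
    rcases le_or_gt s S₁ with h3 | h3
    · exact Or.inl h3
    · refine Or.inr fun x hx => hball ?_
      rw [Real.ball_eq_Ioo] at h₁ h₂ ⊢
      exact ⟨h₁.1.trans_le hx.1, (hx.2.trans hsS).trans_lt h₂.2⟩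
  -- Near `-∞` the past limit puts each solution within `δ` of `Y` at some early time depending on
  -- the solution; the local estimate is uniform in that starting time.
  have hne : {S : ℝ | TracksOn f L Xm Y (Iic S)}.Nonempty := by
    obtain ⟨I, hI, hIt⟩ := exists_tracksLocally hf hm hYa hLa hYf hY
    obtain ⟨S, hS⟩ := mem_atBot_sets.1 hI
    refine ⟨S, fun η hη => ?_⟩
    obtain ⟨δ, hδ, r₀, hr₀, h⟩ := hIt η hη
    refine ⟨r₀, hr₀, fun r hr hrr u hu hlim s hsS => ?_⟩
    have hzero : Tendsto (fun s => ‖u s - Y s‖) atBot (𝓝 0) := by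
      simpa using (hlim.sub hYa).norm
    obtain ⟨s₀, h0, hs₀⟩ := ((hzero.eventually_le_const hδ).and (eventually_le_atBot s)).exists
    exact h r hr hrr u hu s₀ s hs₀ (fun x hx => hS x (hx.2.trans hsS)) h0
  have hclopen : IsClopen {S : ℝ | TracksOn f L Xm Y (Iic S)} := by
    refine ⟨⟨?_⟩, ?_⟩
    · rw [Metric.isOpen_iff]
      intro S hS
      obtain ⟨ε, hε, h⟩ := hstep S
      exact ⟨ε, hε, fun S' hS' hT => hS (h S' hS' S (Metric.mem_ball_self hε) hT)⟩
    · rw [Metric.isOpen_iff]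
      intro S hS
      obtain ⟨ε, hε, h⟩ := hstep S
      exact ⟨ε, hε, fun S' hS' => h S (Metric.mem_ball_self hε) S' hS' hS⟩
  have huniv := hclopen.eq_univ hne
  obtain ⟨I, hI, hIt⟩ := exists_tracksLocally hf hp hYb hLb hYf hY
  obtain ⟨S, hS⟩ := mem_atTop_sets.1 hI
  have hT : TracksOn f L Xm Y (Iic S) := by
    have : S ∈ {S : ℝ | TracksOn f L Xm Y (Iic S)} := huniv ▸ mem_univ S
    exact this
  intro η hη
  obtain ⟨r₀, hr₀, h⟩ := hT.extend hIt η hη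
  exact ⟨r₀, hr₀, fun r hr hrr u hu hlim s _ => h r hr hrr u hu hlim s
    (Or.inr fun x hx => hS x hx.1)⟩

/-- A continuous function vanishing at infinity is bounded; this gives the speed bound for the
tracked curve. -/
theorem IsParameterShift.exists_abs_deriv_le {a b : ℝ} (hL : IsParameterShift a b L) :
    ∃ C, ∀ s, |deriv L s| ≤ C := by
  have hcont : Continuous (deriv L) := hL.contDiff.continuous_deriv (by norm_num)
  have hcoc : Tendsto (deriv L) (cocompact ℝ) (𝓝 0) := by
    rw [cocompact_eq_atBot_atTop]
    exact hL.deriv_atBot.sup hL.deriv_atTop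
  let g : ZeroAtInftyContinuousMap ℝ ℝ := ⟨⟨deriv L, hcont⟩, hcoc⟩
  exact ⟨‖g.toBCF‖, fun s => g.toBCF.norm_coe_le_norm s⟩

theorem IsPullbackAttractorFrom.isSlowSolution {r : ℝ} (hr : 0 < r) {Xm : State n}
    {x : ℝ → State n} (hx : IsPullbackAttractorFrom f L r Xm x) :
    IsSlowSolution f L r (fun s => x (r⁻¹ * s)) := by
  intro s
  have h1 := hx.hasDerivAt (r⁻¹ * s)
  rw [mul_inv_cancel_left₀ hr.ne'] at h1
  have h2 : HasDerivAt (fun s : ℝ => r⁻¹ * s) r⁻¹ s := by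
    simpa using (hasDerivAt_id s).const_mul r⁻¹
  exact h1.scomp s h2

/-- If a curve of linearly stable equilibria starts at `Xm` and extends over `[a, b]`, there is no
B-tipping from `Xm`. -/
theorem IsStabCurve.not_bTipping (hf : ContDiff ℝ 2 (fun p : State n × ℝ => f p.1 p.2))
    {a b : ℝ} (hab : a < b) (hL : IsParameterShift a b L) {Xm : State n} {X : ℝ → State n}
    (hX : IsStabCurve f a b Xm b X) : ¬ BTipping f a b L Xm := by
  rintro ⟨hm, Xp, hp, ⟨r₀, hr₀, hatt⟩, hcon⟩
  have hLI : ∀ s, L s ∈ Icc a b := fun s => Ioo_subset_Icc_self (hL.mem_Ioo s)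
  have hXd : ContDiffOn ℝ 2 X (Icc a b) := fun l hl =>
    contDiffWithinAt_of_equilibria hf hl (hX.mem_stabSet l hl).2 (hX.continuousOn l hl)
      fun m hm => (hX.mem_stabSet m hm).1.1
  obtain ⟨M, hM⟩ := isCompact_Icc.exists_bound_of_continuousOn
    (hXd.continuousOn_derivWithin (uniqueDiffOn_Icc hab) (by norm_num))
  obtain ⟨C, hC⟩ := hL.exists_abs_deriv_le
  set Y : ℝ → State n := fun s => X (L s) with hYdef
  have hY : ∀ s, ∃ y, HasDerivAt Y y s ∧ ‖y‖ ≤ C * M := by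
    intro s
    have h1 : HasDerivAt X (derivWithin X (Icc a b) (L s)) (L s) :=
      ((hXd.differentiableOn (by norm_num)) (L s) (hLI s)).hasDerivWithinAt.hasDerivAt
        (Icc_mem_nhds (hL.mem_Ioo s).1 (hL.mem_Ioo s).2)
    have h2 : HasDerivAt L (deriv L s) s :=
      (hL.contDiff.differentiable (by norm_num) s).hasDerivAt
    refine ⟨_, h1.scomp s h2, ?_⟩
    rw [norm_smul]
    exact mul_le_mul (hC s) (hM _ (hLI s)) (norm_nonneg _) ((abs_nonneg _).trans (hC s))
  have hbI : b ∈ Icc a b := right_mem_Icc.2 hab.le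
  have hYa : Tendsto Y atBot (𝓝 Xm) := by
    have h1 : Tendsto X (𝓝[Icc a b] a) (𝓝 (X a)) := hX.continuousOn a (left_mem_Icc.2 hab.le)
    rw [hX.start] at h1
    exact h1.comp (tendsto_nhdsWithin_iff.2 ⟨hL.tendsto_atBot, Eventually.of_forall hLI⟩)
  have hYb : Tendsto Y atTop (𝓝 (X b)) := by
    have h1 : Tendsto X (𝓝[Icc a b] b) (𝓝 (X b)) := hX.continuousOn b hbI
    exact h1.comp (tendsto_nhdsWithin_iff.2 ⟨hL.tendsto_atTop, Eventually.of_forall hLI⟩)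
  have htrack : TracksOn f L Xm Y univ :=
    tracksOn_univ hf hL.contDiff.continuous hL.tendsto_atBot hL.tendsto_atTop hYa hYb
      (fun s => (hX.mem_stabSet _ (hLI s)).1.1) (fun s => (hX.mem_stabSet _ (hLI s)).2) hm.2
      (hX.mem_stabSet b hbI).2 hY
  -- For each `η` a single rate below both thresholds is enough, because neither `X b` nor `Xp`
  -- depends on `r`.
  have hXp : X b = Xp := by
    rw [eq_comm, ← sub_eq_zero, ← norm_le_zero_iff]
    refine le_of_forall_pos_le_add fun η hη => ?_
    rw [zero_add]
    obtain ⟨r₁, hr₁, h⟩ := htrack η hη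
    have hr : 0 < min r₀ r₁ / 2 := half_pos (lt_min hr₀ hr₁)
    have hlt : min r₀ r₁ / 2 < min r₀ r₁ := half_lt_self (lt_min hr₀ hr₁)
    obtain ⟨x, hx, hxp⟩ := hatt _ hr (hlt.trans_le (min_le_left _ _))
    have h1 := h _ hr (hlt.trans_le (min_le_right _ _)) _ (hx.isSlowSolution hr)
      (hx.tendsto_atBot.comp (tendsto_id.const_mul_atBot (inv_pos.2 hr)))
    have h2 := hxp.comp (tendsto_id.const_mul_atTop (inv_pos.2 hr))
    exact le_of_tendsto (h2.sub hYb).norm (Eventually.of_forall fun s => h1 s (mem_univ s))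
  refine hcon ⟨hm, hp, Y, ?_⟩
  exact
    { continuous := continuous_iff_continuousAt.2 fun s => (hY s).choose_spec.1.continuousAt
      mem_equilibria := fun s => (hX.mem_stabSet _ (hLI s)).1
      tendsto_atBot := hYa
      tendsto_atTop := hXp ▸ hYb
      mem_closure := fun s => subset_closure (hX.mem_stabSet _ (hLI s)) }

end Tracking
end Tipping

theorem corollary3p2 (n : ℕ) (f : Tipping.State n → ℝ → Tipping.State n)
    (hf : ContDiff ℝ 2 (fun p : Tipping.State n × ℝ => f p.1 p.2))
    (lm lp : ℝ) (hl : lm < lp)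
    (hreg : ∀ p : Tipping.State n × ℝ, ¬ AccPt p (𝓟 (Tipping.bifSet f lm lp)))
    (hm : ∀ x : Tipping.State n, (x, lm) ∉ Tipping.bifSet f lm lp)
    (hp : ∀ x : Tipping.State n, (x, lp) ∉ Tipping.bifSet f lm lp)
    (L : ℝ → ℝ) (hL : Tipping.IsParameterShift lm lp L)
    (Xm : Tipping.State n)
    (hbdd : Bornology.IsBounded (Tipping.stableBranchFrom f lm lp Xm))
    (htip : Tipping.BTipping f lm lp L Xm) :
    ∃ (xb : Tipping.State n) (lb : ℝ), lm < lb ∧ lb < lp ∧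
      (xb, lb) ∈ Tipping.bifSet f lm lp ∧ (xb, lb) ∈ Tipping.stableBranchFrom f lm lp Xm := by
  rcases Tipping.exists_mem_bifSet_or_isStabCurve hf hl.le hreg htip.1 hbdd with
    ⟨⟨x, l⟩, hbr, hbif⟩ | ⟨X, hX⟩
  · refine ⟨x, l, lt_of_le_of_ne hbif.1.2.1 ?_, lt_of_le_of_ne hbif.1.2.2 ?_, hbif, hbr⟩
    · rintro rfl
      exact hm x hbif
    · rintro rfl
      exact hp x hbif
  · exact absurd htip (hX.not_bTipping hf hl hL)
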